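/- Let $m\ge 1$ and let $\mathbb{R}_m$ be the real Clifford algebra generated by $e_1,\dots,e_m$ with $e_j^2=-1$ and $e_ie_j=-e_je_i$ for $i\neq j$; a point $x\in\mathbb{R}^m$ is identified with the vector $x=\sum_{j=1}^m x_je_j\in\mathbb{R}_m$. Let $\partial_x=\sum_{j=1}^m e_j\,\partial_{x_j}$ be the Dirac operator, acting from the left on $\mathbb{R}_m$-valued functions. Let $k\ge 0$ be an integer and let $Y_k:\mathbb{R}^m\to\mathbb{R}_m$ be a left monogenic homogeneous polynomial of degree $k$, i.e. $\partial_xY_k=0$. For real $\alpha>-1$ and integers $n\ge 0$, the Clifford–Gegenbauer polynomials are defined, for $|x|<1$, by $$C_{n,m}^{\alpha}(Y_k)(x)=(1-|x|^2)^{-\alpha}\,\partial_x^{\,n}\bigl((1-|x|^2)^{\alpha+n}\,Y_k(x)\bigr).$$ Then for every integer $N\ge 0$ and every $x\in\mathbb{R}^m$ with $|x|<1$, $$x\,C_{2N,m}^{\alpha}(Y_k)(x)=A\,C_{2N+1,m}^{\alpha}(Y_k)(x)+B\,C_{2N-1,m}^{\alpha}(Y_k)(x),$$ $$x\,C_{2N+1,m}^{\alpha}(Y_k)(x)=A'\,C_{2N+2,m}^{\alpha}(Y_k)(x)+B'\,C_{2N,m}^{\alpha}(Y_k)(x),$$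 where $$A=\frac{-(\alpha+k+\frac m2+N)}{2(\alpha+2N+1)(\alpha+k+\frac m2+2N)},\qquad B=\frac{2N(\alpha+2N)}{\alpha+k+\frac m2+2N},$$ $$A'=\frac{-(\alpha+N+1)}{2(\alpha+2N+2)(\alpha+k+\frac m2+2N+1)},\qquad B'=\frac{2(\alpha+2N+1)(k+\frac m2+N)}{\alpha+k+\frac m2+2N+1}.$$ For $N=0$ one has $B=0$ and the term with $C_{-1,m}^{\alpha}(Y_k)$ is absent. The first formula is asserted whenever its denominator $\alpha+k+\frac m2+2N$ is nonzero, which is automatic unless $m=1$, $k=N=0$ and $\alpha=-\frac12$. -/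

import Mathlib

noncomputable section

namespace CliffordGegenbauer

/-- The Euclidean space `ℝ^m`. -/
abbrev Euc (m : ℕ) : Type := EuclideanSpace ℝ (Fin m)

/-- The quadratic form `x ↦ -|x|²` on `ℝ^m`. -/
def negSq (m : ℕ) : QuadraticForm ℝ (Euc m) :=
  -LinearMap.BilinMap.toQuadraticMap (innerₗ (Euc m))

theorem negSq_apply {m : ℕ} (x : Euc m) : negSq m x = -‖x‖ ^ 2 := by
  simp [negSq]

/-- The real Clifford algebra `ℝ_m`, in which every vector satisfies `x² = -|x|²`. -/
abbrev Cl (m : ℕ) : Type := CliffordAlgebra (negSq m)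

/-- The vector `x = ∑ⱼ xⱼ eⱼ` seen as an element of the Clifford algebra. -/
def vec {m : ℕ} (x : Euc m) : Cl m := CliffordAlgebra.ι (negSq m) x

/-- The generator `eⱼ` of the Clifford algebra. -/
def gen {m : ℕ} (j : Fin m) : Cl m := vec (EuclideanSpace.single j 1)

/-- The product `e_A = e_{j₁} ⋯ e_{j_h}` for `A = {j₁ < ⋯ < j_h}`, with `e_∅ = 1`. -/
def genProd {m : ℕ} (A : Finset (Fin m)) : Cl m := (A.sort.map gen).prod

theorem vec_mul_self {m : ℕ} (x : Euc m) : vec x * vec x = algebraMap ℝ (Cl m) (-‖x‖ ^ 2) := by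
  rw [vec, CliffordAlgebra.ι_sq_scalar, negSq_apply]

theorem gen_mul_self {m : ℕ} (j : Fin m) : gen j * gen j = (-1 : Cl m) := by
  simp [gen, vec_mul_self]

theorem gen_mul_gen {m : ℕ} {i j : Fin m} (h : i ≠ j) :
    (gen j * gen i : Cl m) = -(gen i * gen j) := by
  have := CliffordAlgebra.ι_mul_ι_add_swap (Q := negSq m)
    (EuclideanSpace.single j (1 : ℝ)) (EuclideanSpace.single i (1 : ℝ))
  have h2 : QuadraticMap.polar (negSq m) (EuclideanSpace.single j (1 : ℝ))
      (EuclideanSpace.single i (1 : ℝ)) = 0 := by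
    have e1 : inner ℝ (EuclideanSpace.single j (1 : ℝ)) (EuclideanSpace.single i (1 : ℝ)) = 0 := by
      simp [EuclideanSpace.inner_single_left, h.symm]
    simp only [QuadraticMap.polar, negSq_apply]
    rw [norm_add_sq_real, e1]
    ring
  rw [h2, map_zero] at this
  exact eq_neg_of_add_eq_zero_left this

theorem vec_eq_sum {m : ℕ} (x : Euc m) : vec x = ∑ j, x j • (gen j : Cl m) := by
  have hx : x = ∑ j, x j • EuclideanSpace.single j (1 : ℝ) := by
    ext i
    simp [Finset.sum_apply, Pi.single_apply]
  conv_lhs => rw [hx]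
  simp [vec, gen, map_sum]

/-- The basis of `ℝ_m` transported from the basis of exterior products of the standard basis
vectors; it consists of the elements `e_A`, see `clBasis_apply`. -/
def clBasis (m : ℕ) : Module.Basis (Finset (Fin m)) ℝ (Cl m) :=
  (EuclideanSpace.basisFun (Fin m) ℝ).toBasis.ExteriorAlgebra.map
    (CliffordAlgebra.equivExterior (negSq m)).symm

theorem contractLeft_prod {m : ℕ} (d : Module.Dual ℝ (Euc m)) (l : List (Fin m))
    (h : ∀ i ∈ l, d (EuclideanSpace.single i 1) = 0) :
    CliffordAlgebra.contractLeft d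
      ((l.map fun i => ExteriorAlgebra.ι ℝ (EuclideanSpace.single i (1 : ℝ))).prod) = 0 := by
  induction l with
  | nil => simp
  | cons a l ih =>
    rw [List.map_cons, List.prod_cons]
    have h0 := ih fun i hi => h i (List.mem_cons_of_mem _ hi)
    have h1 := h a List.mem_cons_self
    refine (CliffordAlgebra.contractLeft_ι_mul _ _ _).trans ?_
    rw [h0, h1]
    simp

theorem equivExterior_prod {m : ℕ} (l : List (Fin m)) (hl : l.Nodup) :
    CliffordAlgebra.equivExterior (negSq m) ((l.map gen).prod) =
      (l.map fun i => ExteriorAlgebra.ι ℝ (EuclideanSpace.single i (1 : ℝ))).prod := by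
  induction l with
  | nil => simp
  | cons a l ih =>
    rw [List.map_cons, List.prod_cons, List.map_cons, List.prod_cons]
    rw [List.nodup_cons] at hl
    have ih := ih hl.2
    simp only [CliffordAlgebra.equivExterior, CliffordAlgebra.changeFormEquiv_apply] at ih ⊢
    refine (CliffordAlgebra.changeForm_ι_mul _ _ _).trans ?_
    rw [ih, contractLeft_prod, sub_zero]
    intro i hi
    have hne : a ≠ i := fun h => hl.1 (h ▸ hi)
    have e1 : inner ℝ (EuclideanSpace.single a (1 : ℝ)) (EuclideanSpace.single i (1 : ℝ)) = 0 := by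
      simp [EuclideanSpace.inner_single_left, hne]
    simp only [QuadraticMap.associated_apply, neg_apply, negSq_apply]
    rw [norm_add_sq_real, e1]
    simp

theorem clBasis_apply {m : ℕ} (A : Finset (Fin m)) : clBasis m A = genProd A := by
  rw [clBasis, Module.Basis.map_apply, LinearEquiv.symm_apply_eq, genProd,
    equivExterior_prod _ (Finset.sort_nodup _ _), ExteriorAlgebra.basis_apply]
  rw [← Finset.listMap_orderEmbOfFin_finRange A rfl, List.map_map]
  refine (ExteriorAlgebra.ιMulti_apply _).trans ?_
  rw [List.ofFn_eq_map]
  congr 1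
  refine List.map_congr_left fun i _ => ?_
  simp
  rfl

/-- The partial derivative `∂f/∂xⱼ = ∑_A (∂f_A/∂xⱼ) e_A` of `f = ∑_A f_A e_A`. -/
def pderiv {m : ℕ} (j : Fin m) (f : Euc m → Cl m) (x : Euc m) : Cl m :=
  ∑ A : Finset (Fin m),
    lineDeriv ℝ (fun y => (clBasis m).repr (f y) A) x (EuclideanSpace.single j 1) • clBasis m A

/-- The Dirac operator `∂ₓ f = ∑ⱼ eⱼ ∂f/∂xⱼ`. -/
def dirac {m : ℕ} (f : Euc m → Cl m) (x : Euc m) : Cl m :=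
  ∑ j : Fin m, gen j * pderiv j f x

/-- `Y` is a left solid inner spherical monogenic of order `k`: a homogeneous polynomial of
degree `k` with coefficients in the Clifford algebra (the zero polynomial included) such that
`∂ₓ Y = 0` on `ℝ^m`. -/
structure IsSphericalMonogenic {m : ℕ} (k : ℕ) (Y : Euc m → Cl m) : Prop where
  polynomial : ∃ p : Finset (Fin m) → MvPolynomial (Fin m) ℝ,
    (∀ A, (p A).IsHomogeneous k) ∧
      ∀ x : Euc m, Y x = ∑ A, MvPolynomial.eval (fun j => x j) (p A) • genProd A
  monogenic : ∀ x, dirac Y x = 0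

/-- The Clifford–Gegenbauer polynomial
`C_{n,m}^α(Y)(x) = (1 - |x|²)^{-α} ∂ₓⁿ ((1 - |x|²)^{α+n} Y(x))`, for `x` in the open unit ball. -/
def cgp {m : ℕ} (α : ℝ) (n : ℕ) (Y : Euc m → Cl m) (x : Euc m) : Cl m :=
  (1 - ‖x‖ ^ 2) ^ (-α) • (dirac^[n] fun y => (1 - ‖y‖ ^ 2) ^ (α + n) • Y y) x

end CliffordGegenbauer

end

/-! Put r = |x|² and c = k + m/2. Since ∂Y = 0, x² = -r and Y satisfies Euler's identity, the Dirac
operator exchanges the two forms p(r) Y and p(r) x Y, acting on p by a first-order operator in r.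
Hence C_{2N} = p_N(r) Y and C_{2N+1} = q_N(r) x Y (`cgp_even`, `cgp_odd`), where each derivative
raises α by one in the recursion for p_N and q_N. The recursion solves in closed form: p_N is a
multiple of ₂F₁(-N, α+N+c; c; r) and q_N of ₂F₁(-N, α+N+c+1; c+1; r) (`coeff_evenFactor`,
`coeff_oddFactor`). Multiplying by x turns p_N Y into p_N x Y and q_N x Y into -r q_N Y. The Bonnet
formulas thus become contiguous relations, checked coefficient by coefficient in
`evenFactor_succ_eq` and `neg_X_mul_oddFactor`. -/

noncomputable section

namespace CliffordGegenbauer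

/-! ### Radial factors and their hypergeometric coefficients. -/

open Polynomial

/-- The rising factorial `(a)_j = a (a + 1) ⋯ (a + j - 1)`. -/
def rising (a : ℝ) (j : ℕ) : ℝ := ∏ i ∈ Finset.range j, (a + i)

theorem rising_zero (a : ℝ) : rising a 0 = 1 := by simp [rising]

theorem rising_succ (a : ℝ) (j : ℕ) : rising a (j + 1) = rising a j * (a + j) :=
  Finset.prod_range_succ _ _

theorem rising_succ_left (a : ℝ) (j : ℕ) : rising a (j + 1) = a * rising (a + 1) j := by
  rw [rising, Finset.prod_range_succ', mul_comm, rising]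
  simp [add_assoc, add_comm (1 : ℝ)]

theorem rising_pos {a : ℝ} (ha : 0 < a) (j : ℕ) : 0 < rising a j :=
  Finset.prod_pos fun _ _ => by positivity

/-- The action `p ↦ 2 (1 - r) p' - 2 (β + 1) p` of `(1 - r)^{-β} ∂ₓ (1 - r)^{β+1}` on the radial
factor of `p(r) Y`, where `r = |x|²`. -/
def evenStep (β : ℝ) (p : ℝ[X]) : ℝ[X] :=
  2 * derivative p - 2 * (X * derivative p) - C (2 * (β + 1)) * p

/-- The action `p ↦ -2 r (1 - r) p' - 2 c (1 - r) p + 2 (β + 1) r p` of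
`(1 - r)^{-β} ∂ₓ (1 - r)^{β+1}` on the radial factor of `p(r) x Y`, where `r = |x|²`. -/
def oddStep (c β : ℝ) (p : ℝ[X]) : ℝ[X] :=
  -(X * evenStep β p) - C (2 * c) * (p - X * p)

/-- The radial factor of `C_{2N,m}^α(Y)`, where `c = k + m / 2`. -/
def evenFactor (c : ℝ) : ℕ → ℝ → ℝ[X]
  | 0, _ => 1
  | N + 1, α => oddStep c α (evenStep (α + 1) (evenFactor c N (α + 1 + 1)))

/-- The polynomial `p` in `C_{2N+1,m}^α(Y) = p(|x|²) x Y`, where `c = k + m / 2`. -/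
def oddFactor (c : ℝ) (N : ℕ) (α : ℝ) : ℝ[X] := evenStep α (evenFactor c N (α + 1))

theorem evenFactor_succ (c : ℝ) (N : ℕ) (α : ℝ) :
    evenFactor c (N + 1) α = oddStep c α (oddFactor c N (α + 1)) := rfl

theorem coeff_evenStep (β : ℝ) (p : ℝ[X]) (j : ℕ) :
    (evenStep β p).coeff j =
      2 * (j + 1) * p.coeff (j + 1) - 2 * j * p.coeff j - 2 * (β + 1) * p.coeff j := by
  have h2 : (2 : ℝ[X]) = C 2 := rfl
  cases j with
  | zero => simp [evenStep, h2, coeff_derivative, -map_mul]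
  | succ j => simp [evenStep, h2, coeff_derivative, -map_mul]; ring

theorem coeff_oddStep_zero (c β : ℝ) (p : ℝ[X]) :
    (oddStep c β p).coeff 0 = -(2 * c * p.coeff 0) := by
  simp [oddStep, -map_mul]

theorem coeff_oddStep_succ (c β : ℝ) (p : ℝ[X]) (j : ℕ) :
    (oddStep c β p).coeff (j + 1) =
      -(2 * (j + 1) * p.coeff (j + 1) - 2 * j * p.coeff j - 2 * (β + 1) * p.coeff j) -
        2 * c * (p.coeff (j + 1) - p.coeff j) := by
  simp [oddStep, coeff_evenStep, -map_mul]

/-- The coefficients of `evenFactor`. -/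
def evenCoeff (c : ℝ) (N : ℕ) (α : ℝ) (j : ℕ) : ℝ :=
  4 ^ N * rising c N * rising (α + N + 1) N * rising (-N) j * rising (α + N + c) j /
    (rising c j * j.factorial)

/-- The coefficients of `oddFactor`. -/
def oddCoeff (c : ℝ) (N : ℕ) (α : ℝ) (j : ℕ) : ℝ :=
  -2 * 4 ^ N * rising (c + 1) N * rising (α + N + 1) (N + 1) * rising (-N) j *
    rising (α + N + c + 1) j / (rising (c + 1) j * j.factorial)

theorem oddCoeff_eq {c : ℝ} (hc : 0 < c) (N : ℕ) (α : ℝ) (j : ℕ) :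
    oddCoeff c N α j = 2 * (j + 1) * evenCoeff c N (α + 1) (j + 1) -
      2 * j * evenCoeff c N (α + 1) j - 2 * (α + 1) * evenCoeff c N (α + 1) j := by
  have h1 : α + 1 + N + 1 = α + N + 1 + 1 := by ring
  have h2 : α + 1 + N + c = α + N + c + 1 := by ring
  have h3 := rising_pos hc j
  have h4 := rising_pos (show 0 < c + 1 by linarith) j
  -- Writing (c+1)_j through (c)_j leaves a rational identity with the same Pochhammer symbols on
  -- both sides.
  have h5 : rising (c + 1) j = rising c j * (c + j) / c := by
    rw [← rising_succ, rising_succ_left]; field_simp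
  have h6 : rising (c + 1) N = rising c N * (c + N) / c := by
    rw [← rising_succ, rising_succ_left]; field_simp
  have h7 : 0 < c + j := by positivity
  simp only [oddCoeff, evenCoeff, h1, h2, rising_succ _ j, rising_succ_left _ N,
    Nat.factorial_succ, Nat.cast_mul, Nat.cast_succ]
  rw [h5, h6]
  field_simp
  ring

theorem evenCoeff_succ_zero {c : ℝ} (N : ℕ) (α : ℝ) :
    evenCoeff c (N + 1) α 0 = -(2 * c * oddCoeff c N (α + 1) 0) := by
  have h1 : α + (N + 1) + 1 = α + 1 + N + 1 := by ring
  simp only [oddCoeff, evenCoeff, rising_succ_left c N, rising_zero, Nat.cast_succ, h1]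
  simp
  ring

theorem evenCoeff_succ_succ {c : ℝ} (hc : 0 < c) (N : ℕ) (α : ℝ) (j : ℕ) :
    evenCoeff c (N + 1) α (j + 1) =
      -(2 * (j + 1) * oddCoeff c N (α + 1) (j + 1) - 2 * j * oddCoeff c N (α + 1) j -
        2 * (α + 1) * oddCoeff c N (α + 1) j) -
        2 * c * (oddCoeff c N (α + 1) (j + 1) - oddCoeff c N (α + 1) j) := by
  have h1 : α + (N + 1) + 1 = α + 1 + N + 1 := by ring
  have h2 : α + (N + 1) + c = α + 1 + N + c := by ring
  have h3 : -((N : ℝ) + 1) + 1 = -N := by ring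
  have h4 := rising_pos (show 0 < c + 1 by linarith) j
  have h5 : 0 < c + 1 + j := by positivity
  simp only [oddCoeff, evenCoeff, rising_succ_left c, Nat.cast_succ, h1, h2, h3,
    rising_succ_left (-((N : ℝ) + 1)) j, rising_succ_left (α + 1 + N + c) j,
    rising_succ (-(N : ℝ)) j, rising_succ (α + 1 + N + c + 1) j, rising_succ (c + 1) j,
    Nat.factorial_succ, Nat.cast_mul]
  field_simp
  ring

/-- The induction must keep α free, because level N + 1 at α calls level N at α + 2. -/
theorem coeff_evenFactor {c : ℝ} (hc : 0 < c) (N : ℕ) :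
    ∀ (α : ℝ) (j : ℕ), (evenFactor c N α).coeff j = evenCoeff c N α j := by
  induction N with
  | zero =>
    intro α j
    cases j with
    | zero => simp [evenFactor, evenCoeff, rising_zero]
    | succ j =>
      -- The first factor of (-0)_{j+1} is zero, so every higher coefficient vanishes.
      rw [evenFactor, evenCoeff, rising_succ_left (-((0 : ℕ) : ℝ))]
      simp [coeff_one]
  | succ N ih =>
    intro α j
    have ho : ∀ j, (oddFactor c N (α + 1)).coeff j = oddCoeff c N (α + 1) j := fun j => by
      rw [oddFactor, coeff_evenStep, ih, ih, oddCoeff_eq hc]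
    rw [evenFactor_succ]
    cases j with
    | zero => rw [coeff_oddStep_zero, ho, evenCoeff_succ_zero]
    | succ j => rw [coeff_oddStep_succ, ho, ho, evenCoeff_succ_succ hc]

theorem coeff_oddFactor {c : ℝ} (hc : 0 < c) (N : ℕ) (α : ℝ) (j : ℕ) :
    (oddFactor c N α).coeff j = oddCoeff c N α j := by
  rw [oddFactor, coeff_evenStep, coeff_evenFactor hc, coeff_evenFactor hc, oddCoeff_eq hc]

/-! ### Contiguous relations between the radial factors. -/

theorem evenFactor_zero_eq {c α : ℝ} (hα : -1 < α) (h : α + c ≠ 0) :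
    evenFactor c 0 α = C (-(α + c) / (2 * (α + 1) * (α + c))) * oddFactor c 0 α := by
  have : α + 1 ≠ 0 := by linarith
  simp only [oddFactor, evenStep, evenFactor, derivative_one, mul_zero, mul_one, sub_zero, zero_sub]
  rw [← C_neg, ← C_mul, ← C_1]
  congr 1
  field_simp

theorem evenFactor_succ_eq {c α : ℝ} (hc : 0 < c) (hα : -1 < α) (N : ℕ)
    (h : α + c + 2 * (N + 1) ≠ 0) :
    evenFactor c (N + 1) α =
      C (-(α + c + (N + 1)) / (2 * (α + 2 * (N + 1) + 1) * (α + c + 2 * (N + 1)))) *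
          oddFactor c (N + 1) α +
        C (2 * (N + 1) * (α + 2 * (N + 1)) / (α + c + 2 * (N + 1))) * oddFactor c N α := by
  ext j
  rw [coeff_add, coeff_C_mul, coeff_C_mul, coeff_oddFactor hc, coeff_oddFactor hc,
    coeff_evenFactor hc]
  have h1 : α + (N + 1) + 1 = α + N + 1 + 1 := by ring
  have h2 : α + (N + 1) + c = α + N + c + 1 := by ring
  have h3 : -((N : ℝ) + 1) + 1 = -N := by ring
  have h4 : 0 < α + (N + 1) * 2 + 1 := by linarith [N.cast_nonneg (α := ℝ)]
  rw [mul_comm 2 ((N : ℝ) + 1)] at h ⊢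
  simp only [oddCoeff, evenCoeff, Nat.cast_succ, h1, h2, rising_succ_left c N,
    rising_succ (c + 1) N, rising_succ (α + N + 1 + 1), rising_succ_left (α + N + 1) N]
  cases j with
  | zero =>
    simp only [rising_zero, Nat.factorial_zero, Nat.cast_one]
    field_simp
    ring
  | succ j =>
    have h5 := rising_pos (show 0 < c + 1 by linarith) j
    have h6 : 0 < c + 1 + j := by positivity
    simp only [rising_succ_left c j, rising_succ (c + 1) j,
      rising_succ_left (-((N : ℝ) + 1)) j, rising_succ_left (α + N + c + 1) j,
      rising_succ (-(N : ℝ)) j, rising_succ (α + N + c + 1 + 1) j, h3, Nat.factorial_succ,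
      Nat.cast_mul]
    push_cast
    field_simp
    ring

/-- The factor -X is the scalar x² = -r. At degree 0 the left side vanishes and the two terms on the
right must cancel. -/
theorem neg_X_mul_oddFactor {c α : ℝ} (hc : 0 < c) (hα : -1 < α) (N : ℕ) :
    -(X * oddFactor c N α) =
      C (-(α + N + 1) / (2 * (α + 2 * N + 2) * (α + c + 2 * N + 1))) * evenFactor c (N + 1) α +
        C (2 * (α + 2 * N + 1) * (c + N) / (α + c + 2 * N + 1)) * evenFactor c N α := by
  ext j
  rw [coeff_add, coeff_C_mul, coeff_C_mul, coeff_evenFactor hc, coeff_evenFactor hc, coeff_neg]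
  have h1 : α + (N + 1) + 1 = α + N + 1 + 1 := by ring
  have h2 : α + (N + 1) + c = α + N + c + 1 := by ring
  have h3 : -((N : ℝ) + 1) + 1 = -N := by ring
  have hN := N.cast_nonneg (α := ℝ)
  have h4 : 0 < α + 2 * N + 2 := by linarith
  have h5 : 0 < α + c + 2 * N + 1 := by linarith
  have h6 : 0 < α + N + 1 := by linarith
  have h7 : rising (α + N + 1 + 1) N = rising (α + N + 1) N * (α + N + 1 + N) / (α + N + 1) := by
    rw [← rising_succ, rising_succ_left]; field_simp
  have h8 : 0 < c + N := by positivity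
  cases j with
  | zero =>
    simp only [evenCoeff, Nat.cast_succ, h1, h2, coeff_X_mul_zero, rising_succ c N,
      rising_succ (α + N + 1 + 1), h7, rising_zero, Nat.factorial_zero]
    rw [mul_comm 2 (N : ℝ)] at h4 h5 ⊢
    field_simp
    ring
  | succ j =>
    have h9 := rising_pos (show 0 < c + 1 by linarith) j
    have h10 : rising c N = rising (c + 1) N * c / (c + N) := by
      field_simp
      rw [← rising_succ, rising_succ_left, mul_comm]
    rw [coeff_X_mul, coeff_oddFactor hc]
    simp only [oddCoeff, evenCoeff, Nat.cast_succ, h1, h2, h3, rising_succ c N,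
      rising_succ (α + N + 1 + 1), rising_succ (α + N + 1) N, h7, h10,
      rising_succ_left c j, rising_succ (α + N + c + 1) j, rising_succ (-(N : ℝ)) j,
      rising_succ_left (-((N : ℝ) + 1)) j, rising_succ_left (α + N + c) j, Nat.factorial_succ,
      Nat.cast_mul]
    field_simp
    ring

end CliffordGegenbauer

end

/-! ### Partial derivatives and the Dirac operator on radial multiples of Y. -/

noncomputable section

namespace CliffordGegenbauer

/-- `f` has partial derivative `f'` in direction `e_j` at `x`, tested against all linear
functionals. -/
def HasPartialDeriv {m : ℕ} (j : Fin m) (f : Euc m → Cl m) (f' : Cl m) (x : Euc m) : Prop :=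
  ∀ φ : Cl m →ₗ[ℝ] ℝ,
    HasLineDerivAt ℝ (fun y => φ (f y)) (φ f') x (EuclideanSpace.single j 1)

variable {m : ℕ} {j : Fin m} {f g : Euc m → Cl m} {f' g' : Cl m} {x : Euc m}

theorem HasPartialDeriv.pderiv_eq (h : HasPartialDeriv j f f' x) : pderiv j f x = f' := by
  rw [pderiv, ← (clBasis m).sum_repr f']
  refine Finset.sum_congr rfl fun A _ => ?_
  congr 1
  simpa using (h ((clBasis m).coord A)).lineDeriv

/-- A functional composed with `L` is again a functional; this is why all of them are tested, not
only the coordinates. -/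
theorem HasPartialDeriv.linearMap (h : HasPartialDeriv j f f' x) (L : Cl m →ₗ[ℝ] Cl m) :
    HasPartialDeriv j (fun y => L (f y)) (L f') x :=
  fun φ => h (φ ∘ₗ L)

theorem HasPartialDeriv.const_mul (h : HasPartialDeriv j f f' x) (a : Cl m) :
    HasPartialDeriv j (fun y => a * f y) (a * f') x :=
  h.linearMap (LinearMap.mulLeft ℝ a)

theorem HasPartialDeriv.sum {ι : Type*} [Fintype ι] {F : ι → Euc m → Cl m} {F' : ι → Cl m}
    (h : ∀ i, HasPartialDeriv j (F i) (F' i) x) :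
    HasPartialDeriv j (fun y => ∑ i, F i y) (∑ i, F' i) x := by
  intro φ
  simp only [map_sum]
  exact HasDerivAt.fun_sum fun i _ => h i φ

theorem HasPartialDeriv.smul {u : Euc m → ℝ} {u' : ℝ}
    (hu : HasLineDerivAt ℝ u u' x (EuclideanSpace.single j 1)) (h : HasPartialDeriv j f f' x) :
    HasPartialDeriv j (fun y => u y • f y) (u' • f x + u x • f') x := by
  intro φ
  have := HasDerivAt.mul hu (h φ)
  simp only [zero_smul, add_zero] at this
  simp only [map_add, map_smul, smul_eq_mul]
  exact this

theorem hasPartialDeriv_const (a : Cl m) : HasPartialDeriv j (fun _ => a) 0 x := by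
  intro φ
  rw [map_zero]
  exact hasDerivAt_const _ _

theorem hasLineDerivAt_coord (i : Fin m) :
    HasLineDerivAt ℝ (fun y : Euc m => y i) (if i = j then 1 else 0) x
      (EuclideanSpace.single j 1) := by
  have : HasDerivAt (fun t : ℝ => x i + t * (if i = j then (1 : ℝ) else 0))
      (if i = j then 1 else 0) 0 := by
    simpa using ((hasDerivAt_id (0 : ℝ)).mul_const (if i = j then (1 : ℝ) else 0)).const_add (x i)
  refine this.congr_of_eventuallyEq (Filter.Eventually.of_forall fun t => ?_)
  simp

theorem hasLineDerivAt_eval (p : MvPolynomial (Fin m) ℝ) :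
    HasLineDerivAt ℝ (fun y : Euc m => MvPolynomial.eval (fun i => y i) p)
      (MvPolynomial.eval (fun i => x i) (MvPolynomial.pderiv j p)) x
      (EuclideanSpace.single j 1) := by
  induction p using MvPolynomial.induction_on with
  | C a =>
    simp only [MvPolynomial.eval_C, MvPolynomial.pderiv_C, map_zero]
    exact hasDerivAt_const _ _
  | add p q hp hq =>
    simp only [map_add]
    exact HasDerivAt.add hp hq
  | mul_X p i hp =>
    have := HasDerivAt.mul hp (hasLineDerivAt_coord (j := j) (x := x) i)
    simp only [zero_smul, add_zero] at this
    have e : MvPolynomial.eval (fun i => x i) (MvPolynomial.pderiv j (p * MvPolynomial.X i)) =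
        MvPolynomial.eval (fun i => x i) (MvPolynomial.pderiv j p) * x i +
          MvPolynomial.eval (fun i => x i) p * (if i = j then 1 else 0) := by
      by_cases h : i = j <;>
        simp [MvPolynomial.pderiv_X, h, add_comm, mul_comm]
    rw [e]
    simp only [map_mul, MvPolynomial.eval_X]
    exact this

theorem hasLineDerivAt_normSq :
    HasLineDerivAt ℝ (fun y : Euc m => ‖y‖ ^ 2) (2 * x j) x (EuclideanSpace.single j 1) := by
  have h := (hasStrictFDerivAt_norm_sq x).hasFDerivAt.hasLineDerivAt (EuclideanSpace.single j 1)
  simpa [EuclideanSpace.inner_single_right] using h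

theorem hasLineDerivAt_radial {u : ℝ → ℝ} {u' : ℝ} (hu : HasDerivAt u u' (‖x‖ ^ 2)) :
    HasLineDerivAt ℝ (fun y : Euc m => u (‖y‖ ^ 2)) (u' * (2 * x j)) x
      (EuclideanSpace.single j 1) := by
  have h := hasLineDerivAt_normSq (j := j) (x := x)
  refine HasDerivAt.comp (0 : ℝ) (h₂ := u) ?_ h
  simpa using hu

theorem HasPartialDeriv.vec_mul (h : HasPartialDeriv j f f' x) :
    HasPartialDeriv j (fun y => vec y * f y) (gen j * f x + vec x * f') x := by
  have h := HasPartialDeriv.sum fun i : Fin m =>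
    (h.const_mul (gen i)).smul (hasLineDerivAt_coord i)
  simpa [Finset.sum_add_distrib, vec_eq_sum, Finset.sum_mul] using h

theorem dirac_eq {f' : Fin m → Cl m} (h : ∀ j, HasPartialDeriv j f (f' j) x) :
    dirac f x = ∑ j, gen j * f' j :=
  Finset.sum_congr rfl fun j _ => by rw [(h j).pderiv_eq]

theorem lineDeriv_congr_of_eqOn {u v : Euc m → ℝ} {s : Set (Euc m)} (hs : IsOpen s) (hx : x ∈ s)
    (h : Set.EqOn u v s) (w : Euc m) : lineDeriv ℝ u x w = lineDeriv ℝ v x w :=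
  Filter.EventuallyEq.lineDeriv_eq (h.eventuallyEq_of_mem (hs.mem_nhds hx))

theorem dirac_congr {s : Set (Euc m)} (hs : IsOpen s) (hx : x ∈ s) (h : Set.EqOn f g s) :
    dirac f x = dirac g x := by
  simp only [dirac, pderiv]
  refine Finset.sum_congr rfl fun j _ => ?_
  congr 1
  refine Finset.sum_congr rfl fun A _ => ?_
  congr 1
  exact lineDeriv_congr_of_eqOn hs hx (fun y hy => by simp only [h hy]) _

theorem gen_mul_vec (j : Fin m) (x : Euc m) :
    gen j * vec x = -(vec x * gen j) - (2 * x j) • (1 : Cl m) := by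
  have := CliffordAlgebra.ι_mul_ι_add_swap (Q := negSq m) (EuclideanSpace.single j (1 : ℝ)) x
  have h2 : QuadraticMap.polar (negSq m) (EuclideanSpace.single j (1 : ℝ)) x = -(2 * x j) := by
    simp only [QuadraticMap.polar, negSq_apply]
    rw [norm_add_sq_real, EuclideanSpace.inner_single_left]
    simp
    ring
  rw [h2, map_neg, Algebra.algebraMap_eq_smul_one] at this
  rw [gen, vec, vec, eq_sub_of_add_eq this]
  abel

theorem exists_partialDeriv {k : ℕ} {Y : Euc m → Cl m} (hY : IsSphericalMonogenic k Y) :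
    ∃ Y' : Fin m → Euc m → Cl m, (∀ j x, HasPartialDeriv j Y (Y' j x) x) ∧
      ∀ x, ∑ j, x j • Y' j x = (k : ℝ) • Y x := by
  obtain ⟨p, hp, hYp⟩ := hY.polynomial
  refine ⟨fun j x => ∑ A, MvPolynomial.eval (fun i => x i) (MvPolynomial.pderiv j (p A)) •
    genProd A, fun j x => ?_, fun x => ?_⟩
  · have h := HasPartialDeriv.sum fun A : Finset (Fin m) =>
      (hasPartialDeriv_const (j := j) (x := x) (genProd A)).smul (hasLineDerivAt_eval (p A))
    rw [funext hYp]
    simpa using h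
  · simp only [Finset.smul_sum, hYp, smul_smul]
    rw [Finset.sum_comm]
    refine Finset.sum_congr rfl fun A _ => ?_
    rw [← Finset.sum_smul]
    congr 1
    have := congrArg (MvPolynomial.eval fun i => x i) (hp A).sum_X_mul_pderiv
    simpa using this

theorem vec_mul_eq_sum (x : Euc m) (a : Cl m) : vec x * a = ∑ j, x j • (gen j * a) := by
  rw [vec_eq_sum, Finset.sum_mul]
  simp only [smul_mul_assoc]

/-- By the product rule only the derivative of u survives, and ∂_j |x|² = 2 x_j reassembles the
vector x. -/
theorem dirac_radial_smul {k : ℕ} {Y : Euc m → Cl m} (hY : IsSphericalMonogenic k Y)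
    {u : ℝ → ℝ} {u' : ℝ} (hu : HasDerivAt u u' (‖x‖ ^ 2)) :
    dirac (fun y => u (‖y‖ ^ 2) • Y y) x = (2 * u') • (vec x * Y x) := by
  obtain ⟨Y', h1, -⟩ := exists_partialDeriv hY
  rw [dirac_eq fun j => (h1 j x).smul (hasLineDerivAt_radial hu)]
  have h0 : ∑ j, gen j * Y' j x = 0 := by rw [← dirac_eq fun j => h1 j x, hY.monogenic]
  simp only [mul_add, Finset.sum_add_distrib, mul_smul_comm]
  rw [← Finset.smul_sum, h0, smul_zero, add_zero, vec_mul_eq_sum, Finset.smul_sum]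
  refine Finset.sum_congr rfl fun j _ => ?_
  rw [smul_smul]
  congr 1
  ring

/-- The u' term uses x² = -|x|². Moving e_j past x in the other term gives -mY - x ∂Y - 2kY, the
last part by Euler's identity. -/
theorem dirac_radial_smul_vec_mul {k : ℕ} {Y : Euc m → Cl m} (hY : IsSphericalMonogenic k Y)
    {u : ℝ → ℝ} {u' : ℝ} (hu : HasDerivAt u u' (‖x‖ ^ 2)) :
    dirac (fun y => u (‖y‖ ^ 2) • (vec y * Y y)) x =
      (-(2 * ‖x‖ ^ 2 * u') - 2 * (k + (m : ℝ) / 2) * u (‖x‖ ^ 2)) • Y x := by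
  obtain ⟨Y', h1, h2⟩ := exists_partialDeriv hY
  rw [dirac_eq fun j => (h1 j x).vec_mul.smul (hasLineDerivAt_radial hu)]
  have h0 : ∑ j, gen j * Y' j x = 0 := by rw [← dirac_eq fun j => h1 j x, hY.monogenic]
  have e1 : ∑ j, gen j * (u' * (2 * x j)) • (vec x * Y x) = (-(2 * ‖x‖ ^ 2 * u')) • Y x := by
    have : ∑ j, gen j * (u' * (2 * x j)) • (vec x * Y x) =
        (2 * u') • (vec x * (vec x * Y x)) := by
      rw [vec_mul_eq_sum x (vec x * Y x), Finset.smul_sum]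
      refine Finset.sum_congr rfl fun j _ => ?_
      rw [smul_smul, mul_smul_comm]
      congr 1
      ring
    rw [this, ← mul_assoc, vec_mul_self, ← Algebra.smul_def, smul_smul]
    congr 1
    ring
  have e2 : ∑ j, gen j * (gen j * Y x + vec x * Y' j x) = (-(2 * (k + (m : ℝ) / 2))) • Y x := by
    have : ∀ j, gen j * (gen j * Y x + vec x * Y' j x) =
        -Y x - vec x * (gen j * Y' j x) - (2 : ℝ) • (x j • Y' j x) := fun j => by
      rw [mul_add, ← mul_assoc, gen_mul_self, ← mul_assoc, gen_mul_vec, sub_mul, neg_mul, neg_mul,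
        one_mul, mul_assoc, smul_mul_assoc, one_mul, smul_smul]
      abel
    simp only [this, Finset.sum_sub_distrib]
    rw [← Finset.mul_sum, h0, ← Finset.smul_sum, h2]
    simp only [Finset.sum_const, Finset.card_univ, Fintype.card_fin, mul_zero, sub_zero]
    rw [← Nat.cast_smul_eq_nsmul ℝ]
    module
  simp only [mul_add _ (_ • _), Finset.sum_add_distrib]
  rw [e1]
  simp only [mul_smul_comm _ _ (_ + _)]
  rw [← Finset.smul_sum, e2, smul_smul, ← add_smul]
  congr 1
  ring

end CliffordGegenbauer

end

/-! ### Iterated Dirac operators on weighted functions. -/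

noncomputable section

namespace CliffordGegenbauer

open Polynomial

variable {m k : ℕ} {Y : Euc m → Cl m} {x : Euc m}

theorem hasDerivAt_weight_mul (α : ℝ) (p : ℝ[X]) {r : ℝ} (hr : r < 1) :
    HasDerivAt (fun r => (1 - r) ^ (α + 1) * p.eval r)
      ((1 - r) ^ α * ((1 - r) * (derivative p).eval r - (α + 1) * p.eval r)) r := by
  have h : 0 < 1 - r := sub_pos.2 hr
  have h1 := (((hasDerivAt_id r).const_sub 1).rpow_const (p := α + 1) (Or.inl h.ne')).mul
    (p.hasDerivAt r)
  refine h1.congr_deriv ?_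
  simp only [id, add_sub_cancel_right, Real.rpow_add_one h.ne']
  ring

theorem normSq_lt_one (hx : ‖x‖ < 1) : ‖x‖ ^ 2 < 1 :=
  pow_lt_one₀ (norm_nonneg _) hx two_ne_zero

/-- `f` will be an iterate of `dirac`, known explicitly only inside the ball; openness of the ball
suffices. -/
theorem dirac_weight_mul_smul (hY : IsSphericalMonogenic k Y) (α : ℝ) (p : ℝ[X])
    {f : Euc m → Cl m}
    (hf : ∀ y, ‖y‖ < 1 → f y = ((1 - ‖y‖ ^ 2) ^ (α + 1) * p.eval (‖y‖ ^ 2)) • Y y)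
    (hx : ‖x‖ < 1) :
    dirac f x = ((1 - ‖x‖ ^ 2) ^ α * (evenStep α p).eval (‖x‖ ^ 2)) • (vec x * Y x) := by
  rw [dirac_congr Metric.isOpen_ball (mem_ball_zero_iff.2 hx)
      fun y hy => hf y (mem_ball_zero_iff.1 hy),
    dirac_radial_smul hY (hasDerivAt_weight_mul α p (normSq_lt_one hx))]
  congr 1
  simp [evenStep]
  ring

theorem dirac_weight_mul_smul_vec_mul (hY : IsSphericalMonogenic k Y) (α : ℝ) (p : ℝ[X])
    {f : Euc m → Cl m}
    (hf : ∀ y, ‖y‖ < 1 → f y = ((1 - ‖y‖ ^ 2) ^ (α + 1) * p.eval (‖y‖ ^ 2)) • (vec y * Y y))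
    (hx : ‖x‖ < 1) :
    dirac f x =
      ((1 - ‖x‖ ^ 2) ^ α * (oddStep (k + (m : ℝ) / 2) α p).eval (‖x‖ ^ 2)) • Y x := by
  rw [dirac_congr Metric.isOpen_ball (mem_ball_zero_iff.2 hx)
      fun y hy => hf y (mem_ball_zero_iff.1 hy),
    dirac_radial_smul_vec_mul hY (hasDerivAt_weight_mul α p (normSq_lt_one hx))]
  congr 1
  rw [Real.rpow_add_one (sub_pos.2 (normSq_lt_one hx)).ne']
  simp [evenStep, oddStep]
  ring

theorem dirac_iterate_odd_of_even (hY : IsSphericalMonogenic k Y) {N : ℕ}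
    (h : ∀ (α : ℝ) (x : Euc m), ‖x‖ < 1 →
      dirac^[2 * N] (fun y => (1 - ‖y‖ ^ 2) ^ (α + (2 * N : ℕ)) • Y y) x =
        ((1 - ‖x‖ ^ 2) ^ α * (evenFactor (k + (m : ℝ) / 2) N α).eval (‖x‖ ^ 2)) • Y x)
    (α : ℝ) (hx : ‖x‖ < 1) :
    dirac^[2 * N + 1] (fun y => (1 - ‖y‖ ^ 2) ^ (α + (2 * N + 1 : ℕ)) • Y y) x =
      ((1 - ‖x‖ ^ 2) ^ α * (oddFactor (k + (m : ℝ) / 2) N α).eval (‖x‖ ^ 2)) •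
        (vec x * Y x) := by
  -- The same weight is read as 2N derivatives at parameter α + 1; the last derivative lowers the
  -- parameter to α.
  have e : α + (2 * N + 1 : ℕ) = α + 1 + (2 * N : ℕ) := by push_cast; ring
  rw [Function.iterate_succ_apply', e]
  exact dirac_weight_mul_smul hY α _ (h (α + 1)) hx

theorem dirac_iterate_even (hY : IsSphericalMonogenic k Y) (N : ℕ) :
    ∀ (α : ℝ) (x : Euc m), ‖x‖ < 1 →
      dirac^[2 * N] (fun y => (1 - ‖y‖ ^ 2) ^ (α + (2 * N : ℕ)) • Y y) x =
        ((1 - ‖x‖ ^ 2) ^ α * (evenFactor (k + (m : ℝ) / 2) N α).eval (‖x‖ ^ 2)) • Y x := by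
  induction N with
  | zero => intro α x _; simp [evenFactor]
  | succ N ih =>
    intro α x hx
    have e : α + (2 * (N + 1) : ℕ) = α + 1 + (2 * N + 1 : ℕ) := by push_cast; ring
    rw [e, show 2 * (N + 1) = (2 * N + 1) + 1 by ring, Function.iterate_succ_apply']
    exact dirac_weight_mul_smul_vec_mul hY α _
      (fun y hy => dirac_iterate_odd_of_even hY ih (α + 1) hy) hx

theorem rpow_neg_smul_smul (hx : ‖x‖ < 1) (α b : ℝ) (a : Cl m) :
    (1 - ‖x‖ ^ 2) ^ (-α) • ((1 - ‖x‖ ^ 2) ^ α * b) • a = b • a := by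
  have h : 0 < 1 - ‖x‖ ^ 2 := sub_pos.2 (normSq_lt_one hx)
  rw [smul_smul, ← mul_assoc, ← Real.rpow_add h, neg_add_cancel, Real.rpow_zero, one_mul]

theorem cgp_even (hY : IsSphericalMonogenic k Y) (α : ℝ) (N : ℕ) (hx : ‖x‖ < 1) :
    cgp α (2 * N) Y x = (evenFactor (k + (m : ℝ) / 2) N α).eval (‖x‖ ^ 2) • Y x := by
  rw [cgp, dirac_iterate_even hY N α x hx, rpow_neg_smul_smul hx]

theorem cgp_odd (hY : IsSphericalMonogenic k Y) (α : ℝ) (N : ℕ) (hx : ‖x‖ < 1) :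
    cgp α (2 * N + 1) Y x =
      (oddFactor (k + (m : ℝ) / 2) N α).eval (‖x‖ ^ 2) • (vec x * Y x) := by
  rw [cgp, dirac_iterate_odd_of_even hY (dirac_iterate_even hY N) α hx, rpow_neg_smul_smul hx]

end CliffordGegenbauer

end

open CliffordGegenbauer in
/-- Bonnet formulas for the Clifford–Gegenbauer polynomials. In the first formula the denominator
condition only excludes `m = 1`, `k = N = 0`, `α = -1/2`; for `N = 0` the coefficient of the
second term is zero, so the index `2 * N - 1` is only relevant for `N ≥ 1`. -/
theorem mainTheorem6 (m k : ℕ) (hm : 1 ≤ m) (α : ℝ) (hα : -1 < α)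
    (Y : Euc m → Cl m) (hY : IsSphericalMonogenic k Y) (N : ℕ) (x : Euc m) (hx : ‖x‖ < 1) :
    (α + k + (m : ℝ) / 2 + 2 * N ≠ 0 →
      vec x * cgp α (2 * N) Y x =
        (-(α + k + (m : ℝ) / 2 + N) /
            (2 * (α + 2 * N + 1) * (α + k + (m : ℝ) / 2 + 2 * N))) • cgp α (2 * N + 1) Y x +
        (2 * N * (α + 2 * N) / (α + k + (m : ℝ) / 2 + 2 * N)) • cgp α (2 * N - 1) Y x) ∧
    vec x * cgp α (2 * N + 1) Y x =
      (-(α + N + 1) /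
          (2 * (α + 2 * N + 2) * (α + k + (m : ℝ) / 2 + 2 * N + 1))) • cgp α (2 * N + 2) Y x +
      (2 * (α + 2 * N + 1) * (k + (m : ℝ) / 2 + N) /
          (α + k + (m : ℝ) / 2 + 2 * N + 1)) • cgp α (2 * N) Y x := by
  have hc : 0 < k + (m : ℝ) / 2 := by
    have : (1 : ℝ) ≤ m := by exact_mod_cast hm
    positivity
  rw [show α + k + (m : ℝ) / 2 = α + (k + (m : ℝ) / 2) by ring]
  refine ⟨fun h => ?_, ?_⟩
  · rw [cgp_even hY α N hx, cgp_odd hY α N hx, mul_smul_comm]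
    cases N with
    | zero =>
      -- Here `2 * N - 1` truncates to 0, harmlessly, since its coefficient is zero.
      simp only [Nat.cast_zero, mul_zero, add_zero, zero_mul, zero_div, zero_smul] at h ⊢
      rw [evenFactor_zero_eq hα h, Polynomial.eval_mul, Polynomial.eval_C, smul_smul]
    | succ N =>
      rw [show 2 * (N + 1) - 1 = 2 * N + 1 by lia, cgp_odd hY α N hx]
      push_cast at h ⊢
      rw [evenFactor_succ_eq hc hα N h, Polynomial.eval_add, Polynomial.eval_mul,
        Polynomial.eval_mul, Polynomial.eval_C, Polynomial.eval_C, add_smul, smul_smul, smul_smul]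
  · have h := congrArg (Polynomial.eval (‖x‖ ^ 2)) (neg_X_mul_oddFactor hc hα N)
    simp only [Polynomial.eval_add, Polynomial.eval_mul, Polynomial.eval_neg, Polynomial.eval_C,
      Polynomial.eval_X] at h
    rw [show 2 * N + 2 = 2 * (N + 1) by ring, cgp_odd hY α N hx, cgp_even hY α (N + 1) hx,
      cgp_even hY α N hx, smul_smul, smul_smul, ← add_smul, ← h, mul_smul_comm, ← mul_assoc,
      vec_mul_self, ← Algebra.smul_def, smul_smul]
    congr 1
    ring
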